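/- Conventions. A dimension function is an increasing (not necessarily strictly) continuous function $f:[0,\infty)\to[0,\infty)$ with $f(0)=0$; $\mathcal H^f$ denotes the Hausdorff measure with gauge $U\mapsto f(\operatorname{diam} U)$, and $\mathcal H^\delta$ denotes $\mathcal H^f$ for $f(r)=r^\delta$. For $\delta>0$, a set $X\subset\mathbb R^d$ is called Ahlfors $\delta$-regular if there are a Borel measure $\mu$ on $\mathbb R^d$ whose topological support is $X$ (so $X$ is closed) and constants $0<c_1<1<c_2<\infty$, $r_0>0$ such that $c_1r^\delta\le\mu(B(x,r))\le c_2r^\delta$ for all $x\in X$ and $0<r\le r_0$. A ball in $X$ is a set $B(x,r)=\{y\in X:|x-y|<r\}$ with $x\in X$, $r>0$, taken together with its centre and radius, and for $B=B(x,r)$ we put $B^f=B(x,f(r)^{1/\delta})$ (empty if $f(r)=0$). Finally $\limsup_{i\to\infty} A_i=\bigcap_{n}\bigcup_{i\ge n}A_i$. Theorem (Mass Transference Principle). Let $\delta>0$ and let $X\subset\mathbb R^d$ be Ahlfors $\delta$-regular. Let $(B_i)_{i\in\mathbb N}$ be a sequence of balls in $X$ whose radii tend to $0$ as $i\to\infty$.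 Let $f$ be a dimension function such that $r\mapsto r^{-\delta}f(r)$ is monotonic (increasing or decreasing) on $(0,\infty)$. Suppose that for every ball $B$ in $X$ $$\mathcal H^\delta\Bigl(B\cap\limsup_{i\to\infty}B_i^f\Bigr)=\mathcal H^\delta(B).$$ Then for every ball $B$ in $X$ $$\mathcal H^f\Bigl(B\cap\limsup_{i\to\infty}B_i\Bigr)=\mathcal H^f(B).$$ -/

import Mathlib

open MeasureTheory Metric Set Filter Topology
open scoped NNReal ENNReal

/-- A dimension function: an increasing (in the weak sense) continuous function
`f : [0, ∞) → [0, ∞)` with `f 0 = 0`. -/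
structure IsDimensionFunction (f : ℝ≥0 → ℝ≥0) : Prop where
  monotone : Monotone f
  continuous : Continuous f
  map_zero : f 0 = 0

/-- The Hausdorff measure `𝓗^f` of a function `f : [0, ∞) → [0, ∞)`: Carathéodory's construction
from the gauge `U ↦ f (diam U)`. Only covers by sets of arbitrarily small diameter matter, so the
value `∞` given to sets of infinite diameter plays no role. -/
noncomputable def hausdorffGauge {Y : Type*} [EMetricSpace Y] [MeasurableSpace Y] [BorelSpace Y]
    (f : ℝ≥0 → ℝ≥0) : Measure Y :=
  Measure.mkMetric (fun t : ℝ≥0∞ => if t = ∞ then ∞ else (f t.toNNReal : ℝ≥0∞))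

/-- A measure `μ` is Ahlfors `δ`-regular if `c₁ r ^ δ ≤ μ (B(x, r)) ≤ c₂ r ^ δ` for all points `x`
of its topological support and all `0 < r ≤ r₀`. -/
def IsAhlforsRegularMeasure {Y : Type*} [MetricSpace Y] [MeasurableSpace Y]
    (δ : ℝ) (μ : Measure Y) : Prop :=
  ∃ c₁ c₂ r₀ : ℝ, 0 < c₁ ∧ c₁ < 1 ∧ 1 < c₂ ∧ 0 < r₀ ∧
    ∀ x ∈ μ.support, ∀ r : ℝ, 0 < r → r ≤ r₀ →
      ENNReal.ofReal (c₁ * r ^ δ) ≤ μ (ball x r) ∧ μ (ball x r) ≤ ENNReal.ofReal (c₂ * r ^ δ)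

/-- A subset `X` of a metric space is Ahlfors `δ`-regular if it is the topological support of an
Ahlfors `δ`-regular measure. (In particular `X` is closed.) -/
def IsAhlforsRegular {Y : Type*} [MetricSpace Y] [MeasurableSpace Y] (δ : ℝ) (X : Set Y) : Prop :=
  ∃ μ : Measure Y, IsAhlforsRegularMeasure δ μ ∧ μ.support = X

/-- The open ball of the subspace `X` with centre `x` and radius `r`. -/
def ballIn {Y : Type*} [MetricSpace Y] (X : Set Y) (x : Y) (r : ℝ≥0) : Set Y :=
  ball x (r : ℝ) ∩ X

/-! Let R_i = f(ρ_i)^(1/δ) be the radius of B_i^f. The measure H^δ inherits the growth r^δ, so the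
hypothesis says that H^δ-almost every point lies in infinitely many B(x_i, R_i). By
`gauge_bounded_or_large` there are two cases. If r^(-δ) f(r) is bounded near 0, then eventually R_i
≤ C ρ_i; shrinking the balls by a bounded factor loses only a null set
(`HasBallGrowth.ae_mem_limsup_ball`), and H^f is absolutely continuous with respect to H^δ.
Otherwise r^(-δ) f(r) decreases and tends to infinity at 0, and the limsup set has infinite
H^f-measure in every ball.

For the second case no Cantor measure is built; a cover of finite cost is refuted directly. Let sets
U_j of diameter at most t_j cover the limsup set in a ball of radius r, with Σ f(t_j) finite. As
f(t) dominates t^δ, a fine cover has Σ t_j^δ ≤ c r^δ. Disjoint balls B(x_i, R_i) carry a fixed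
proportion of r^δ, and double counting yields one whose core B(x_i, ρ_i) misses the first N sets and
meets only sets with Σ f(t_j) ≤ c R_i^δ = c f(ρ_i) (`HasBallGrowth.exists_subball`). Since r^(-δ)
f(r) decreases, this gives Σ t_j^δ ≤ c ρ_i^δ over those sets, so the step repeats inside the core.
The nested cores share a point of the limsup set lying in no U_j
(`HasBallGrowth.not_subset_iUnion`). -/

/-- Every ball of radius `r ≤ r₀` has `ν`-measure between `c₁ r ^ δ` and `c₂ r ^ δ`. -/
structure HasBallGrowth {Y : Type*} [MetricSpace Y] [MeasurableSpace Y]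
    (δ : ℝ) (c₁ c₂ r₀ : ℝ≥0) (ν : Measure Y) : Prop where
  lower_pos : 0 < c₁
  upper_pos : 0 < c₂
  radius_pos : 0 < r₀
  le_ball : ∀ x : Y, ∀ r : ℝ≥0, 0 < r → r ≤ r₀ → (c₁ : ℝ≥0∞) * (r ^ δ : ℝ≥0) ≤ ν (ball x r)
  ball_le : ∀ x : Y, ∀ r : ℝ≥0, 0 < r → r ≤ r₀ → ν (ball x r) ≤ (c₂ : ℝ≥0∞) * (r ^ δ : ℝ≥0)

/-! ### Packing bounds and growth of Hausdorff measure -/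

section BallGrowth

variable {Y : Type*} [MetricSpace Y] [MeasurableSpace Y]
  {δ : ℝ} {c₁ c₂ r₀ : ℝ≥0} {ν : Measure Y}

theorem HasBallGrowth.packing [BorelSpace Y] (h : HasBallGrowth δ c₁ c₂ r₀ ν) {ι : Type*} {u : Set ι}
    {x : ι → Y} {R : ι → ℝ≥0} (hR : ∀ i ∈ u, 0 < R i) (hR₀ : ∀ i ∈ u, R i ≤ r₀)
    (hdisj : u.PairwiseDisjoint fun i => closedBall (x i) (R i)) {a : Y} {s : ℝ≥0}
    (hs : 0 < s) (hs₀ : s ≤ r₀) (hsub : ∀ i ∈ u, closedBall (x i) (R i) ⊆ ball a s) :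
    (c₁ : ℝ≥0∞) * ∑' i : u, ((R i ^ δ : ℝ≥0) : ℝ≥0∞) ≤ c₂ * (s ^ δ : ℝ≥0) := by
  rw [← ENNReal.tsum_mul_left]
  calc ∑' i : u, (c₁ : ℝ≥0∞) * ((R i ^ δ : ℝ≥0) : ℝ≥0∞)
      ≤ ∑' i : u, ν (closedBall (x i) (R i)) := ENNReal.tsum_le_tsum fun i =>
        (h.le_ball (x i) (R i) (hR i i.2) (hR₀ i i.2)).trans (measure_mono ball_subset_closedBall)
    _ ≤ ν (⋃ i : u, closedBall (x i) (R i)) :=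
        tsum_meas_le_meas_iUnion_of_disjoint ν (fun i => measurableSet_closedBall)
          fun i j hij => hdisj i.2 j.2 fun h => hij (Subtype.ext h)
    _ ≤ ν (ball a s) := measure_mono (iUnion_subset fun i => hsub i i.2)
    _ ≤ c₂ * (s ^ δ : ℝ≥0) := h.ball_le a s hs hs₀

/-- The set lies in an open ball of every radius exceeding `t`; let that radius decrease to `t`. -/
theorem HasBallGrowth.measure_le (h : HasBallGrowth δ c₁ c₂ r₀ ν) (hδ : 0 < δ) {s : Set Y}
    {t : ℝ≥0} (ht : t < r₀) (hs : ∀ a ∈ s, ∀ b ∈ s, dist a b ≤ t) :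
    ν s ≤ c₂ * (t ^ δ : ℝ≥0) := by
  rcases s.eq_empty_or_nonempty with rfl | ⟨a, ha⟩
  · simp
  have hcont : Tendsto (fun e : ℝ≥0 => (c₂ : ℝ≥0∞) * (e ^ δ : ℝ≥0)) (𝓝[>] t)
      (𝓝 (c₂ * (t ^ δ : ℝ≥0))) := by
    have : Continuous fun e : ℝ≥0 => ((c₂ * e ^ δ : ℝ≥0) : ℝ≥0∞) :=
      ENNReal.continuous_coe.comp
        (continuous_const.mul (NNReal.continuous_rpow_const hδ.le))
    simpa using (this.tendsto t).mono_left nhdsWithin_le_nhds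
  refine ge_of_tendsto hcont ?_
  filter_upwards [Ioc_mem_nhdsGT ht] with e he
  refine (measure_mono fun b hb => ?_).trans (h.ball_le a e (pos_of_gt he.1) he.2)
  exact (hs b hb a ha).trans_lt (by exact_mod_cast he.1)

/-- The Hausdorff measure of a space carrying a measure with ball growth `r ^ δ` has the same
growth. -/
theorem HasBallGrowth.hausdorffMeasure [BorelSpace Y] [SecondCountableTopology Y]
    (h : HasBallGrowth δ c₁ c₂ r₀ ν) (hδ : 0 < δ) :
    HasBallGrowth δ (c₁ / c₂) (16 ^ δ * c₂ / c₁) (r₀ / 2) (μH[δ] : Measure Y) := by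
  have hc₁ := h.lower_pos
  have hc₂ := h.upper_pos
  have hr₀ := h.radius_pos
  refine ⟨by positivity, by positivity, by positivity, fun x r hr hrr => ?_, fun x r hr hrr => ?_⟩
  -- Mass distribution principle: a small set of diameter t has ν-mass at most c₂ t^δ.
  · have hle : (c₂⁻¹ : ℝ≥0) • ν ≤ μH[δ] := by
      refine Measure.le_hausdorffMeasure δ _ ((r₀ / 2 : ℝ≥0) : ℝ≥0∞)
        (by exact_mod_cast (by positivity : 0 < r₀ / 2)) fun s hs => ?_
      lift ediam s to ℝ≥0 using ne_top_of_le_ne_top ENNReal.coe_ne_top hs with t ht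
      have hν := h.measure_le hδ (s := s) (t := t)
        ((ENNReal.coe_le_coe.1 hs).trans_lt (NNReal.half_lt_self hr₀.ne')) fun a ha b hb => by
          have := edist_le_ediam_of_mem ha hb
          rw [← ht, edist_nndist] at this
          exact_mod_cast this
      rw [Measure.smul_apply, ENNReal.smul_def, smul_eq_mul, ← ENNReal.coe_rpow_of_nonneg _ hδ.le]
      calc ((c₂⁻¹ : ℝ≥0) : ℝ≥0∞) * ν s ≤ ((c₂⁻¹ : ℝ≥0) : ℝ≥0∞) * (c₂ * (t ^ δ : ℝ≥0)) := by gcongr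
        _ = (t ^ δ : ℝ≥0) := by
          rw [← mul_assoc, ← ENNReal.coe_mul, inv_mul_cancel₀ hc₂.ne']; simp
    refine le_trans ?_ (hle (ball x r))
    rw [Measure.smul_apply, ENNReal.smul_def, smul_eq_mul, div_eq_inv_mul, ENNReal.coe_mul,
      mul_assoc]
    gcongr
    exact h.le_ball x r hr (hrr.trans (half_le_self zero_le))
  · obtain ⟨ε, hε, hεlim⟩ : ∃ ε : ℕ → ℝ≥0, (∀ n, 0 < ε n ∧ ε n ≤ r) ∧ Tendsto ε atTop (𝓝 0) := by
      refine ⟨fun n => r / (n + 1), fun n => ⟨by positivity, div_le_self zero_le (by simp)⟩, ?_⟩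
      simpa [div_eq_mul_inv] using
        (tendsto_one_div_add_atTop_nhds_zero_nat (𝕜 := ℝ≥0)).const_mul r
    -- Balls of equal radius ε: the enlarged ones have diameter at most 8ε and cover, while the
    -- disjoint ones pack into radius 2r, whence 16 = 8 · 2.
    have hvit := fun n => Vitali.exists_disjoint_subfamily_covering_enlargement_closedBall
      (ball x (r : ℝ)) (fun z : Y => z) (fun _ => (ε n : ℝ)) (ε n) (fun _ _ => le_rfl) 4
      (by norm_num)
    choose u hu hdisj hcov using hvit
    have hcount : ∀ n, Countable (u n) := fun n => by
      refine ((hdisj n).countable_of_nonempty_interior fun a _ => ⟨a, ?_⟩).to_subtype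
      exact ball_subset_interior_closedBall (mem_ball_self (by exact_mod_cast (hε n).1))
    have hdiam : ∀ n (i : u n), ediam (closedBall (i : Y) (4 * (ε n : ℝ))) ≤
        ((8 * ε n : ℝ≥0) : ℝ≥0∞) := fun n i => by
      refine ediam_le fun a ha b hb => ?_
      rw [edist_nndist]
      norm_cast
      rw [← NNReal.coe_le_coe, coe_nndist]
      push_cast
      have := dist_triangle_right a b i
      rw [mem_closedBall] at ha hb
      linarith
    refine (Measure.hausdorffMeasure_le_liminf_tsum (ι := fun n => u n) (l := atTop) δ
      (ball x r) (fun n => ((8 * ε n : ℝ≥0) : ℝ≥0∞)) ?_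
      (fun n i => closedBall (i : Y) (4 * (ε n : ℝ))) (Eventually.of_forall hdiam)
      (Eventually.of_forall fun n z hz => ?_)).trans ?_
    · have := hεlim.const_mul 8
      rw [mul_zero] at this
      simpa only [ENNReal.coe_zero] using ENNReal.tendsto_coe.2 this
    · obtain ⟨b, hb, hsub⟩ := hcov n z hz
      exact mem_iUnion.2 ⟨⟨b, hb⟩, hsub (mem_closedBall_self (ε n).2)⟩
    · refine liminf_le_of_le (by isBoundedDefault) fun b hb => ?_
      obtain ⟨n, hn⟩ := hb.exists
      refine hn.trans ?_
      have hpack := h.packing (u := u n) (x := fun z => z) (R := fun _ => ε n)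
        (fun _ _ => (hε n).1)
        (fun _ _ => (hε n).2.trans (hrr.trans (half_le_self zero_le))) (hdisj n)
        (a := x) (s := 2 * r) (by positivity)
        (by rw [mul_comm]; exact (le_div_iff₀ (by norm_num)).1 hrr) fun z hz w hw => by
          have h1 := hu n hz
          have h2 : (ε n : ℝ) ≤ r := by exact_mod_cast (hε n).2
          rw [mem_ball] at h1 ⊢
          rw [mem_closedBall] at hw
          have := dist_triangle w z x
          push_cast
          linarith
      calc ∑' i : u n, ediam (closedBall (i : Y) (4 * (ε n : ℝ))) ^ δ
          ≤ ∑' _ : u n, ((8 ^ δ : ℝ≥0) : ℝ≥0∞) * ((ε n ^ δ : ℝ≥0) : ℝ≥0∞) := by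
            refine ENNReal.tsum_le_tsum fun i => ?_
            refine (ENNReal.rpow_le_rpow (hdiam n i) hδ.le).trans_eq ?_
            rw [← ENNReal.coe_rpow_of_nonneg _ hδ.le, NNReal.mul_rpow, ENNReal.coe_mul]
        _ = ((8 ^ δ / c₁ : ℝ≥0) : ℝ≥0∞) *
              (c₁ * ∑' _ : u n, ((ε n ^ δ : ℝ≥0) : ℝ≥0∞)) := by
            rw [ENNReal.tsum_mul_left, ← mul_assoc, ← ENNReal.coe_mul, div_mul_cancel₀ _ hc₁.ne']
        _ ≤ ((8 ^ δ / c₁ : ℝ≥0) : ℝ≥0∞) * (c₂ * ((2 * r) ^ δ : ℝ≥0)) := by gcongr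
        _ = ((16 ^ δ * c₂ / c₁ : ℝ≥0) : ℝ≥0∞) * (r ^ δ : ℝ≥0) := by
            norm_cast
            rw [NNReal.mul_rpow, show (16 : ℝ≥0) = 8 * 2 by norm_num, NNReal.mul_rpow]
            ring

end BallGrowth

/-! ### Disjoint families of large balls, and how many a small set can hit -/

section Covering

variable {Y : Type*} [MetricSpace Y] [MeasurableSpace Y]
  {δ : ℝ} {c₁ c₂ r₀ : ℝ≥0} {ν : Measure Y}

/-- If almost every point lies in infinitely many balls `B (x i, R i)`, then every small ball
contains a disjoint family of such closed balls, with indices in a prescribed eventual set, which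
carries a fixed proportion of the mass. -/
theorem HasBallGrowth.exists_disjoint_family (h : HasBallGrowth δ c₁ c₂ r₀ ν)
    {x : ℕ → Y} {R : ℕ → ℝ≥0} (hR : ∀ i, 0 < R i) (hRlim : Tendsto R atTop (𝓝 0))
    (hfull : ∀ᵐ z ∂ν, ∃ᶠ i in atTop, z ∈ ball (x i) (R i)) {p : ℕ → Prop}
    (hp : ∀ᶠ i in atTop, p i) (y : Y) {r : ℝ≥0} (hr : 0 < r) (hr₀ : r ≤ r₀) :
    ∃ u : Set ℕ, (∀ i ∈ u, p i ∧ R i ≤ r ∧ closedBall (x i) (R i) ⊆ ball y r) ∧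
      (u.PairwiseDisjoint fun i => closedBall (x i) (R i)) ∧
      (c₁ : ℝ≥0∞) * (r ^ δ : ℝ≥0) ≤
        ((c₂ * 12 ^ δ : ℝ≥0) : ℝ≥0∞) * ∑' i : u, ((R i ^ δ : ℝ≥0) : ℝ≥0∞) := by
  -- The margins fit: a ball of radius below r/8 meeting B(y, r/2) has its centre within 5r/8 < 3r/4
  -- of y, and 3r/4 + r/8 < r keeps it inside B(y, r).
  set T : Set ℕ := {i | (p i ∧ R i < r / 8) ∧ dist (x i) y < 3 / 4 * r}
  have hev : ∀ᶠ i in atTop, p i ∧ R i < r / 8 :=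
    hp.and (hRlim.eventually (gt_mem_nhds (by positivity)))
  obtain ⟨u, huT, hdisj, hcov⟩ :=
    Vitali.exists_disjoint_subfamily_covering_enlargement_closedBall T x (fun i => (R i : ℝ)) r
      (fun i hi => by
        have : R i ≤ r := hi.1.2.le.trans (div_le_self zero_le (by norm_num))
        exact_mod_cast this) 5 (by norm_num)
  have hR8 : ∀ i ∈ u, (R i : ℝ) < r / 8 := fun i hi => by exact_mod_cast (huT hi).1.2
  refine ⟨u, fun i hi => ⟨(huT hi).1.1,
    (huT hi).1.2.le.trans (div_le_self zero_le (by norm_num)), fun z hz => ?_⟩, hdisj, ?_⟩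
  · have h1 := (huT hi).2
    have h2 := hR8 i hi
    rw [mem_closedBall] at hz
    rw [mem_ball]
    have := dist_triangle z (x i) y
    have : (0 : ℝ) < r := by exact_mod_cast hr
    linarith
  -- The factor 6 turns Vitali's closed 5-fold enlargement into an open ball; with the halved radius
  -- it produces the constant 12.
  have hcover : ball y ((r / 2 : ℝ≥0) : ℝ) ≤ᵐ[ν] ⋃ i : u, ball (x i) ((6 * R i : ℝ≥0) : ℝ) := by
    filter_upwards [hfull] with z hz hzy
    obtain ⟨i, hzi, hi⟩ := (hz.and_eventually hev).exists
    have hiT : i ∈ T := by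
      refine ⟨hi, ?_⟩
      have h1 : dist z y < ((r / 2 : ℝ≥0) : ℝ) := hzy
      have h2 : dist z (x i) < R i := hzi
      have h3 : (R i : ℝ) < r / 8 := by exact_mod_cast hi.2
      have := dist_triangle_left (x i) y z
      push_cast at h1
      have : (0 : ℝ) < r := by exact_mod_cast hr
      linarith
    obtain ⟨b, hb, hsub⟩ := hcov i hiT
    refine mem_iUnion.2 ⟨⟨b, hb⟩, ?_⟩
    have h1 := hsub (ball_subset_closedBall hzi)
    have : (0 : ℝ) < R b := by exact_mod_cast hR b
    rw [mem_closedBall] at h1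
    rw [mem_ball]
    push_cast
    linarith
  have h2δ : (0 : ℝ≥0) < 2 ^ δ := by positivity
  have key : (c₁ : ℝ≥0∞) * ((r / 2) ^ δ : ℝ≥0) ≤
      ((c₂ * 6 ^ δ : ℝ≥0) : ℝ≥0∞) * ∑' i : u, ((R i ^ δ : ℝ≥0) : ℝ≥0∞) :=
    calc (c₁ : ℝ≥0∞) * ((r / 2) ^ δ : ℝ≥0) ≤ ν (ball y ((r / 2 : ℝ≥0) : ℝ)) :=
          h.le_ball y _ (by positivity) ((half_le_self zero_le).trans hr₀)
      _ ≤ ν (⋃ i : u, ball (x i) ((6 * R i : ℝ≥0) : ℝ)) := measure_mono_ae hcover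
      _ ≤ ∑' i : u, ν (ball (x i) ((6 * R i : ℝ≥0) : ℝ)) := measure_iUnion_le _
      _ ≤ ∑' i : u, ((c₂ * 6 ^ δ : ℝ≥0) : ℝ≥0∞) * ((R i ^ δ : ℝ≥0) : ℝ≥0∞) := by
          refine ENNReal.tsum_le_tsum fun i => ?_
          refine (h.ball_le (x i) _ (mul_pos (by norm_num) (hR i)) ?_).trans_eq ?_
          · have h1 := hR8 i i.2
            have h2 : (r : ℝ) ≤ r₀ := by exact_mod_cast hr₀
            have : (0 : ℝ) < r := by exact_mod_cast hr
            rw [← NNReal.coe_le_coe]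
            push_cast
            linarith
          · rw [NNReal.mul_rpow]
            push_cast
            ring
      _ = _ := ENNReal.tsum_mul_left
  calc (c₁ : ℝ≥0∞) * (r ^ δ : ℝ≥0)
      = ((2 ^ δ : ℝ≥0) : ℝ≥0∞) * (c₁ * ((r / 2) ^ δ : ℝ≥0)) := by
        rw [NNReal.div_rpow]
        norm_cast
        field_simp
    _ ≤ ((2 ^ δ : ℝ≥0) : ℝ≥0∞) *
          (((c₂ * 6 ^ δ : ℝ≥0) : ℝ≥0∞) * ∑' i : u, ((R i ^ δ : ℝ≥0) : ℝ≥0∞)) := by gcongr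
    _ = _ := by
        rw [← mul_assoc, ← ENNReal.coe_mul, show (12 : ℝ≥0) = 2 * 6 by norm_num, NNReal.mul_rpow]
        congr 2
        ring

/-- A set of diameter at most `t` meeting the concentric cores of several large disjoint balls
meets only balls of total mass at most a multiple of `t ^ δ`. -/
theorem HasBallGrowth.tsum_hit_le [BorelSpace Y] (h : HasBallGrowth δ c₁ c₂ r₀ ν)
    {x : ℕ → Y} {ρ R : ℕ → ℝ≥0} (hR : ∀ i, 0 < R i) {u : Set ℕ}
    (hρR : ∀ i ∈ u, 8 * ρ i ≤ R i)
    (hdisj : u.PairwiseDisjoint fun i => closedBall (x i) (R i))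
    {V : Set Y} {t : ℝ≥0} (ht : 0 < t) (ht₀ : 6 * t ≤ r₀) (hV : ∀ a ∈ V, ∀ b ∈ V, dist a b ≤ t)
    (hhit : ∀ i ∈ u, (V ∩ closedBall (x i) (ρ i)).Nonempty)
    (hlarge : (∀ i ∈ u, R i ≤ t) ∨ u.Nontrivial) :
    (c₁ : ℝ≥0∞) * ∑' i : u, ((R i ^ δ : ℝ≥0) : ℝ≥0∞) ≤
      ((c₂ * 6 ^ δ : ℝ≥0) : ℝ≥0∞) * (t ^ δ : ℝ≥0) := by
  have ht' : (0 : ℝ) < t := by exact_mod_cast ht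
  have hρR' : ∀ i ∈ u, 8 * (ρ i : ℝ) ≤ R i := fun i hi => by exact_mod_cast hρR i hi
  -- A set meeting two cores must cross the gap between them: the centres are at distance D
  -- exceeding both radii, and D ≤ t + R_i/8 + R_k/8, which bounds both radii by 2t.
  have hR2 : ∀ i ∈ u, (R i : ℝ) ≤ 2 * t := by
    intro i hi
    rcases hlarge with hl | hnt
    · have : (R i : ℝ) ≤ t := by exact_mod_cast hl i hi
      linarith
    · obtain ⟨k, hk, hki⟩ := hnt.exists_ne i
      obtain ⟨a, haV, hai⟩ := hhit i hi
      obtain ⟨b, hbV, hbk⟩ := hhit k hk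
      have h1 : (R k : ℝ) < dist (x i) (x k) := by
        by_contra! hle
        exact Set.disjoint_left.1 (hdisj hi hk hki.symm) (mem_closedBall_self (R i).2) hle
      have h2 : (R i : ℝ) < dist (x i) (x k) := by
        by_contra! hle
        refine Set.disjoint_left.1 (hdisj hi hk hki.symm) (?_ : x k ∈ _)
          (mem_closedBall_self (R k).2)
        rwa [mem_closedBall, dist_comm]
      have h3 := hV a haV b hbV
      rw [mem_closedBall] at hai hbk
      have h4 := dist_triangle4 (x i) a b (x k)
      rw [dist_comm (x i) a] at h4
      have := hρR' i hi
      have := hρR' k hk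
      linarith
  rcases u.eq_empty_or_nonempty with rfl | ⟨k, hk⟩
  · simp
  obtain ⟨a, haV, -⟩ := hhit k hk
  refine (h.packing (fun i _ => hR i) (fun i hi => ?_) hdisj (a := a) (s := 6 * t)
    (by positivity) ht₀ fun i hi z hz => ?_).trans_eq ?_
  · refine le_trans ?_ ht₀
    have := hR2 i hi
    rw [← NNReal.coe_le_coe]
    push_cast
    linarith
  · obtain ⟨b, hbV, hbi⟩ := hhit i hi
    rw [mem_closedBall] at hz hbi
    have h1 := hV b hbV a haV
    have h2 := dist_triangle4 z (x i) b a
    rw [dist_comm (x i) b] at h2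
    have := hR2 i hi
    have := hρR' i hi
    have : (0 : ℝ) < R i := by exact_mod_cast hR i
    rw [mem_ball]
    push_cast
    linarith
  · rw [NNReal.mul_rpow]
    push_cast
    ring

end Covering

/-! ### The descent step by double counting -/

/-- The indices of the members of a family of sets which meet `B`. -/
def meeting {Y : Type*} (U : ℕ → Set Y) (B : Set Y) : Set ℕ :=
  {j | (U j ∩ B).Nonempty}

section Nesting

variable {Y : Type*} [MetricSpace Y] [MeasurableSpace Y] [BorelSpace Y]
  {δ : ℝ} {c₁ c₂ r₀ : ℝ≥0} {ν : Measure Y}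

open Classical in
/-- The descent step: if the members of a family `U` which meet a ball have small total mass, then
some smaller ball `B (x i, ρ i)` avoids a prescribed finite part of `U` and the members of `U`
which meet it have small total weight in comparison with `R i ^ δ`. -/
theorem HasBallGrowth.exists_subball (h : HasBallGrowth δ c₁ c₂ r₀ ν)
    {x : ℕ → Y} {ρ R : ℕ → ℝ≥0} (hR : ∀ i, 0 < R i) (hRlim : Tendsto R atTop (𝓝 0))
    (hρR : ∀ᶠ i in atTop, 8 * ρ i ≤ R i)
    (hfull : ∀ᵐ z ∂ν, ∃ᶠ i in atTop, z ∈ ball (x i) (R i))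
    {U : ℕ → Set Y} {t v : ℕ → ℝ≥0} (ht : ∀ j, 0 < t j)
    (hU : ∀ j, ∀ a ∈ U j, ∀ b ∈ U j, dist a b ≤ t j) (hv : ∑' j, (v j : ℝ≥0∞) ≠ ∞)
    {c : ℝ≥0} (hc0 : 0 < c) (hc : 2 * ((c₂ * 12 ^ δ) * (c₂ * 6 ^ δ) * c) ≤ c₁ ^ 2)
    {y : Y} {r : ℝ≥0} (hr : 0 < r) (hr₀ : 6 * r ≤ r₀)
    (hsmall : ∀ j ∈ meeting U (closedBall y r), t j ≤ r)
    (hmass : ∑' j : meeting U (closedBall y r), ((t j ^ δ : ℝ≥0) : ℝ≥0∞) ≤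
      ((c * r ^ δ : ℝ≥0) : ℝ≥0∞)) (N : ℕ) :
    ∃ i, N ≤ i ∧ closedBall (x i) (ρ i) ⊆ ball y r ∧
      (∀ j < N, j ∉ meeting U (closedBall (x i) (ρ i))) ∧
      ∑' j : meeting U (closedBall (x i) (ρ i)), (v j : ℝ≥0∞) ≤ ((c * R i ^ δ : ℝ≥0) : ℝ≥0∞) := by
  have hc₁ := h.lower_pos
  have hc₂ := h.upper_pos
  -- Chosen so that the tail of `v` outside `J` accounts for exactly a quarter of c₁² r^δ in the
  -- final inequality.
  set e : ℝ≥0 := c₁ * c * r ^ δ / (4 * (c₂ * 12 ^ δ)) with he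
  have he0 : 0 < e := by positivity
  obtain ⟨J, hJN, hJ⟩ : ∃ J : Finset ℕ, Finset.range N ⊆ J ∧
      ∑' j : {j // j ∉ J}, (v j : ℝ≥0∞) < e :=
    ((eventually_ge_atTop (Finset.range N)).and
      ((ENNReal.tendsto_tsum_compl_atTop_zero hv).eventually
        (gt_mem_nhds (by exact_mod_cast he0)))).exists
  have hev : ∀ᶠ i in atTop, N ≤ i ∧ 8 * ρ i ≤ R i ∧ ∀ j ∈ J, R i ≤ t j :=
    (eventually_ge_atTop N).and (hρR.and ((Filter.eventually_all_finset J).2 fun j _ =>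
      hRlim.eventually (ge_mem_nhds (ht j))))
  obtain ⟨u, hu, hdisj, hW⟩ := h.exists_disjoint_family hR hRlim hfull hev y hr
    (le_trans (le_mul_of_one_le_left zero_le (by norm_num)) hr₀)
  have hsub : ∀ i ∈ u, closedBall (x i) (ρ i) ⊆ closedBall (x i) (R i) := fun i hi =>
    closedBall_subset_closedBall (by
      exact_mod_cast le_trans (le_mul_of_one_le_left zero_le (by norm_num)) (hu i hi).1.2.1)
  by_contra! hbad
  set P : ℕ → ℕ → Prop := fun i j => i ∈ u ∧ j ∈ meeting U (closedBall (x i) (ρ i)) with hP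
  -- The large members: those in `J`, since every R_i in the family is at most their t_j, and those
  -- hitting at least two cores. These are the two alternatives of `HasBallGrowth.tsum_hit_le`.
  set L : ℕ → Prop := fun j => j ∈ J ∨ {i | P i j}.Nontrivial with hL
  set w : ℕ → ℝ≥0∞ := fun i => ((R i ^ δ : ℝ≥0) : ℝ≥0∞) with hw
  -- A charge from U_j to each core it hits. If every candidate fails, each core receives at least
  -- c₁ R_i^δ: from one large member, or from small members whose `v`-weights exceed c R_i^δ in
  -- total.
  set a : ℕ → ℕ → ℝ≥0∞ := fun i j =>
    if P i j then (if L j then c₁ * w i else ((c₁ / c : ℝ≥0) : ℝ≥0∞) * v j) else 0 with ha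
  have hrow : ∀ i, u.indicator (fun i => (c₁ : ℝ≥0∞) * w i) i ≤ ∑' j, a i j := by
    intro i
    by_cases hi : i ∈ u
    swap
    · simp [hi]
    rw [indicator_of_mem hi]
    by_cases hex : ∃ j, P i j ∧ L j
    · obtain ⟨j, hPj, hLj⟩ := hex
      refine le_trans ?_ (ENNReal.le_tsum j)
      simp [ha, hPj, hLj]
    · push Not at hex
      have hlt := hbad i (hu i hi).1.1 ((hsub i hi).trans (hu i hi).2.2) fun j hj hm =>
        hex j ⟨hi, hm⟩ (Or.inl (hJN (Finset.mem_range.2 hj)))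
      have hrw : ∑' j, a i j = ((c₁ / c : ℝ≥0) : ℝ≥0∞) *
          ∑' j : meeting U (closedBall (x i) (ρ i)), (v j : ℝ≥0∞) := by
        rw [tsum_subtype (meeting U (closedBall (x i) (ρ i))) (fun j => (v j : ℝ≥0∞)),
          ← ENNReal.tsum_mul_left]
        refine tsum_congr fun j => ?_
        by_cases hj : j ∈ meeting U (closedBall (x i) (ρ i))
        · have hPj : P i j := ⟨hi, hj⟩
          simp [ha, hPj, hex j hPj, hj]
        · have hPj : ¬ P i j := fun hPj => hj hPj.2
          simp [ha, hPj, hj]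
      rw [hrw]
      calc (c₁ : ℝ≥0∞) * w i = ((c₁ / c : ℝ≥0) : ℝ≥0∞) * ((c * R i ^ δ : ℝ≥0) : ℝ≥0∞) := by
            rw [hw, ← ENNReal.coe_mul, ← ENNReal.coe_mul]
            congr 1
            field_simp
        _ ≤ _ := by gcongr
  -- A large member pays at most a multiple of t_j^δ. Any other member hits at most one core and
  -- lies outside `J`, so it pays at most a multiple of v_j.
  have hcol : ∀ j, ∑' i, a i j ≤
      ((c₂ * 6 ^ δ : ℝ≥0) : ℝ≥0∞) *
        (meeting U (closedBall y r)).indicator (fun j => ((t j ^ δ : ℝ≥0) : ℝ≥0∞)) j +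
      ((c₁ / c : ℝ≥0) : ℝ≥0∞) * {j | j ∉ J}.indicator (fun j => (v j : ℝ≥0∞)) j := by
    intro j
    by_cases hex : ∃ k, P k j
    swap
    · push Not at hex
      simp [ha, hex]
    obtain ⟨k, hk⟩ := hex
    by_cases hLj : L j
    · refine le_trans ?_ le_self_add
      have hjm : j ∈ meeting U (closedBall y r) :=
        hk.2.mono (inter_subset_inter_right _
          (((hsub k hk.1).trans (hu k hk.1).2.2).trans ball_subset_closedBall))
      rw [indicator_of_mem hjm]
      have hrw : ∑' i, a i j = c₁ * ∑' i : {i | P i j}, w i := by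
        rw [tsum_subtype {i | P i j} w, ← ENNReal.tsum_mul_left]
        refine tsum_congr fun i => ?_
        by_cases hPi : P i j <;> simp [ha, hPi, hLj]
      rw [hrw]
      refine h.tsum_hit_le hR (fun i hi => (hu i hi.1).1.2.1)
        (hdisj.subset fun i hi => hi.1) (ht j)
        ((mul_le_mul_right (hsmall j hjm) 6).trans hr₀) (hU j) (fun i hi => hi.2) ?_
      exact hLj.imp_left fun hj i hi => (hu i hi.1).1.2.2 j hj
    · refine le_trans ?_ le_add_self
      have hjJ : j ∉ J := fun hj => hLj (Or.inl hj)
      have hsubs : {i | P i j}.Subsingleton := Set.not_nontrivial_iff.1 fun hn => hLj (Or.inr hn)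
      rw [tsum_eq_single k fun i hik => ?_]
      · simp [ha, hk, hLj, hjJ]
      · have hPi : ¬ P i j := fun hPi => hik (hsubs hPi hk)
        simp [ha, hPi]
  have hsum : (c₁ : ℝ≥0∞) * ∑' i : u, w i ≤
      ((c₂ * 6 ^ δ * (c * r ^ δ) + c₁ / c * e : ℝ≥0) : ℝ≥0∞) := by
    calc (c₁ : ℝ≥0∞) * ∑' i : u, w i
        = ∑' i, u.indicator (fun i => (c₁ : ℝ≥0∞) * w i) i := by
          rw [← ENNReal.tsum_mul_left, ← tsum_subtype u fun i => (c₁ : ℝ≥0∞) * w i]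
      _ ≤ ∑' i, ∑' j, a i j := ENNReal.tsum_le_tsum hrow
      _ = ∑' j, ∑' i, a i j := ENNReal.tsum_comm
      _ ≤ _ := ENNReal.tsum_le_tsum hcol
      _ = ((c₂ * 6 ^ δ : ℝ≥0) : ℝ≥0∞) *
            (∑' j : meeting U (closedBall y r), ((t j ^ δ : ℝ≥0) : ℝ≥0∞)) +
          ((c₁ / c : ℝ≥0) : ℝ≥0∞) * ∑' j : {j | j ∉ J}, (v j : ℝ≥0∞) := by
          rw [ENNReal.tsum_add, ENNReal.tsum_mul_left, ENNReal.tsum_mul_left,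
            ← tsum_subtype (meeting U (closedBall y r)) fun j => ((t j ^ δ : ℝ≥0) : ℝ≥0∞),
            ← tsum_subtype {j | j ∉ J} fun j => (v j : ℝ≥0∞)]
      _ ≤ ((c₂ * 6 ^ δ : ℝ≥0) : ℝ≥0∞) * ((c * r ^ δ : ℝ≥0) : ℝ≥0∞) +
          ((c₁ / c : ℝ≥0) : ℝ≥0∞) * (e : ℝ≥0∞) := by
          gcongr
          exact hJ.le
      _ = _ := by push_cast; rfl
  have hfin : (c₁ : ℝ≥0∞) * (c₁ * (r ^ δ : ℝ≥0)) ≤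
      ((c₂ * 12 ^ δ : ℝ≥0) : ℝ≥0∞) *
        ((c₂ * 6 ^ δ * (c * r ^ δ) + c₁ / c * e : ℝ≥0) : ℝ≥0∞) :=
    calc (c₁ : ℝ≥0∞) * (c₁ * (r ^ δ : ℝ≥0))
        ≤ c₁ * (((c₂ * 12 ^ δ : ℝ≥0) : ℝ≥0∞) * ∑' i : u, w i) := by gcongr
      _ = ((c₂ * 12 ^ δ : ℝ≥0) : ℝ≥0∞) * (c₁ * ∑' i : u, w i) := by ring
      _ ≤ _ := by gcongr
  have hfin' : c₁ * (c₁ * r ^ δ) ≤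
      c₂ * 12 ^ δ * (c₂ * 6 ^ δ * (c * r ^ δ) + c₁ / c * e) := by exact_mod_cast hfin
  -- The two contributions are at most 1/4 and 1/2 of c₁² r^δ, yet must add up to at least all of
  -- it.
  have h1 : c₂ * 12 ^ δ * (c₁ / c * e) = c₁ ^ 2 * r ^ δ / 4 := by
    rw [he]
    field_simp
  have h2 : 2 * (c₂ * 12 ^ δ * (c₂ * 6 ^ δ * (c * r ^ δ))) ≤ c₁ ^ 2 * r ^ δ := by
    calc 2 * (c₂ * 12 ^ δ * (c₂ * 6 ^ δ * (c * r ^ δ)))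
        = 2 * ((c₂ * 12 ^ δ) * (c₂ * 6 ^ δ) * c) * r ^ δ := by ring
      _ ≤ _ := by gcongr
  have h3 : 0 < c₁ ^ 2 * r ^ δ := by positivity
  rw [mul_add, h1, ← mul_assoc, ← pow_two] at hfin'
  rw [← NNReal.coe_le_coe] at hfin' h2
  rw [← NNReal.coe_lt_coe] at h3
  push_cast at hfin' h2 h3
  linarith

end Nesting

/-! ### Nested cores and infinite measure -/

section Infinite

variable {Y : Type*} [MetricSpace Y] [MeasurableSpace Y] [BorelSpace Y] [CompleteSpace Y]
  {δ : ℝ} {c₁ c₂ r₀ : ℝ≥0} {ν : Measure Y}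

/-- A countable family of sets cannot cover `limsup B (x i, ρ i)` inside a ball if the gauges of
its members are summable and the members meeting that ball are small with small total mass. -/
theorem HasBallGrowth.not_subset_iUnion (h : HasBallGrowth δ c₁ c₂ r₀ ν)
    {x : ℕ → Y} {ρ R : ℕ → ℝ≥0} (hρ : ∀ i, 0 < ρ i) (hρlim : Tendsto ρ atTop (𝓝 0))
    (hR : ∀ i, 0 < R i) (hRlim : Tendsto R atTop (𝓝 0)) (hρR : ∀ᶠ i in atTop, 8 * ρ i ≤ R i)
    (hfull : ∀ᵐ z ∂ν, ∃ᶠ i in atTop, z ∈ ball (x i) (R i))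
    {f : ℝ≥0 → ℝ≥0} (hf : Monotone f) (hRf : ∀ i, R i ^ δ = f (ρ i))
    (hanti : ∀ s t : ℝ≥0, 0 < s → s ≤ t → f t * s ^ δ ≤ f s * t ^ δ)
    {U : ℕ → Set Y} {t : ℕ → ℝ≥0} (ht : ∀ j, 0 < t j)
    (hU : ∀ j, ∀ a ∈ U j, ∀ b ∈ U j, dist a b ≤ t j) (hsum : ∑' j, (f (t j) : ℝ≥0∞) ≠ ∞)
    {c : ℝ≥0} (hc0 : 0 < c) (hc1 : c < 1) (hc : 2 * ((c₂ * 12 ^ δ) * (c₂ * 6 ^ δ) * c) ≤ c₁ ^ 2)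
    {y : Y} {r : ℝ≥0} (hr : 0 < r) (hr₀ : 6 * r ≤ r₀)
    (hsmall : ∀ j ∈ meeting U (closedBall y r), t j ≤ r)
    (hmass : ∑' j : meeting U (closedBall y r), ((t j ^ δ : ℝ≥0) : ℝ≥0∞) ≤
      ((c * r ^ δ : ℝ≥0) : ℝ≥0∞)) :
    ¬ ball y r ∩ limsup (fun i => ball (x i) (ρ i)) atTop ⊆ ⋃ j, U j := by
  intro hcover
  set Good : Y → ℝ≥0 → Prop := fun y r => 0 < r ∧ 6 * r ≤ r₀ ∧
    (∀ j ∈ meeting U (closedBall y r), t j ≤ r) ∧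
    ∑' j : meeting U (closedBall y r), ((t j ^ δ : ℝ≥0) : ℝ≥0∞) ≤ ((c * r ^ δ : ℝ≥0) : ℝ≥0∞)
  obtain ⟨N₀, hN₀⟩ : ∃ N₀, ∀ i ≥ N₀, ρ i < r₀ / 6 := eventually_atTop.1
    (hρlim.eventually (gt_mem_nhds (div_pos h.radius_pos (by norm_num))))
  have step : ∀ y r, Good y r → ∀ N, ∃ i, N ≤ i ∧ closedBall (x i) (ρ i) ⊆ ball y r ∧
      (∀ j < N, j ∉ meeting U (closedBall (x i) (ρ i))) ∧ Good (x i) (ρ i) := by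
    rintro y r ⟨hr, hr₀, hsmall, hmass⟩ N
    obtain ⟨i, hi, hsub, havoid, hle⟩ := h.exists_subball hR hRlim hρR hfull ht hU hsum hc0 hc hr
      hr₀ hsmall hmass (max N N₀)
    have hfρ : 0 < f (ρ i) := hRf i ▸ NNReal.rpow_pos (hR i)
    -- A single term satisfies f(t_j) ≤ c f(ρ_i) < f(ρ_i) because c < 1; monotonicity of f then
    -- compares the radii.
    have hlt : ∀ j ∈ meeting U (closedBall (x i) (ρ i)), t j ≤ ρ i := by
      intro j hj
      have h1 : ((f (t j) : ℝ≥0) : ℝ≥0∞) ≤ ((c * R i ^ δ : ℝ≥0) : ℝ≥0∞) :=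
        (ENNReal.le_tsum (f := fun j : meeting U (closedBall (x i) (ρ i)) =>
          ((f (t j) : ℝ≥0) : ℝ≥0∞)) ⟨j, hj⟩).trans hle
      rw [ENNReal.coe_le_coe, hRf] at h1
      exact (hf.reflect_lt (h1.trans_lt (mul_lt_of_lt_one_left hfρ hc1))).le
    refine ⟨i, (le_max_left _ _).trans hi, hsub,
      fun j hj => havoid j (hj.trans_le (le_max_left _ _)), hρ i, ?_, hlt, ?_⟩
    · have := (hN₀ i ((le_max_right _ _).trans hi)).le
      rw [le_div_iff₀ (by norm_num)] at this
      rwa [mul_comm]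
    · calc ∑' j : meeting U (closedBall (x i) (ρ i)), ((t j ^ δ : ℝ≥0) : ℝ≥0∞)
          ≤ ∑' j : meeting U (closedBall (x i) (ρ i)),
              ((ρ i ^ δ / f (ρ i) : ℝ≥0) : ℝ≥0∞) * (f (t j) : ℝ≥0∞) := by
            refine ENNReal.tsum_le_tsum fun j => ?_
            rw [← ENNReal.coe_mul, ENNReal.coe_le_coe, div_mul_eq_mul_div, le_div_iff₀ hfρ,
              mul_comm, mul_comm (ρ i ^ δ)]
            exact hanti _ _ (ht j) (hlt j j.2)
        _ ≤ ((ρ i ^ δ / f (ρ i) : ℝ≥0) : ℝ≥0∞) * ((c * R i ^ δ : ℝ≥0) : ℝ≥0∞) := by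
            rw [ENNReal.tsum_mul_left]
            gcongr
        _ = ((c * ρ i ^ δ : ℝ≥0) : ℝ≥0∞) := by
            rw [← ENNReal.coe_mul, hRf]
            congr 1
            field_simp
  obtain ⟨i₀, -, hsub₀, -, hgood₀⟩ := step y r ⟨hr, hr₀, hsmall, hmass⟩ 0
  choose g hgN hgsub hgavoid hggood using
    fun p : {i // Good (x i) (ρ i)} => step (x p) (ρ p) p.2 (p + 1)
  obtain ⟨s, hs0, hs⟩ : ∃ s : ℕ → {i // Good (x i) (ρ i)}, s 0 = ⟨i₀, hgood₀⟩ ∧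
      ∀ n, s (n + 1) = ⟨g (s n), hggood (s n)⟩ :=
    ⟨fun n => Nat.rec ⟨i₀, hgood₀⟩ (fun _ p => ⟨g p, hggood p⟩) n, rfl, fun _ => rfl⟩
  have hsN : ∀ n, (s n).1 + 1 ≤ (s (n + 1)).1 := fun n => by
    rw [hs]
    exact hgN (s n)
  have hssub : ∀ n, closedBall (x (s (n + 1))) (ρ (s (n + 1))) ⊆ ball (x (s n)) (ρ (s n)) :=
    fun n => by
      rw [hs]
      exact hgsub (s n)
  have hsavoid : ∀ n, ∀ j < (s n).1 + 1,
      j ∉ meeting U (closedBall (x (s (n + 1))) (ρ (s (n + 1)))) := fun n => by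
    rw [hs]
    exact hgavoid (s n)
  have hsmono : StrictMono fun n => (s n : ℕ) := strictMono_nat_of_lt_succ fun n => Nat.lt_of_succ_le (hsN n)
  have hKanti : Antitone fun n => closedBall (x (s n)) (ρ (s n)) :=
    antitone_nat_of_succ_le fun n => (hssub n).trans ball_subset_closedBall
  obtain ⟨z, hz⟩ : (⋂ n, closedBall (x (s n)) (ρ (s n))).Nonempty := by
    refine Metric.nonempty_iInter_of_nonempty_biInter (fun n => isClosed_closedBall)
      (fun n => isBounded_closedBall) (fun N => ⟨x (s N), ?_⟩) ?_
    · exact mem_iInter₂.2 fun n hn => hKanti hn (mem_closedBall_self (ρ (s N)).2)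
    · have hlim : Tendsto (fun n => 2 * (ρ (s n) : ℝ)) atTop (𝓝 0) := by
        have := (NNReal.tendsto_coe.2 (hρlim.comp hsmono.tendsto_atTop)).const_mul 2
        simpa using this
      exact squeeze_zero (fun n => diam_nonneg) (fun n => diam_closedBall (ρ (s n)).2) hlim
  rw [mem_iInter] at hz
  have hzlim : z ∈ limsup (fun i => ball (x i) (ρ i)) atTop := by
    rw [mem_limsup_iff_frequently_mem, frequently_atTop]
    exact fun n => ⟨s n, hsmono.id_le n, hssub n (hz (n + 1))⟩
  obtain ⟨j, hj⟩ := mem_iUnion.1 (hcover ⟨hsub₀ (by simpa only [hs0] using hz 0), hzlim⟩)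
  -- The index chosen at stage j is at least j, so the core at stage j + 1 already avoids U_j.
  exact hsavoid j j (Nat.lt_succ_of_le (hsmono.id_le j)) ⟨z, hj, hz (j + 1)⟩

/-- If `f` dominates every multiple of `r ^ δ` near zero, then `limsup B (x i, ρ i)` has infinite
`𝓗^f`-measure in every ball. -/
theorem HasBallGrowth.hausdorffGauge_eq_top (h : HasBallGrowth δ c₁ c₂ r₀ ν) (hδ : 0 < δ)
    {x : ℕ → Y} {ρ : ℕ → ℝ≥0} (hρ : ∀ i, 0 < ρ i) (hρlim : Tendsto ρ atTop (𝓝 0))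
    {f : ℝ≥0 → ℝ≥0} (hf : IsDimensionFunction f)
    (hfull : ∀ᵐ z ∂ν, ∃ᶠ i in atTop, z ∈ ball (x i) ((f (ρ i) ^ (1 / δ) : ℝ≥0) : ℝ))
    (hanti : ∀ s t : ℝ≥0, 0 < s → s ≤ t → f t * s ^ δ ≤ f s * t ^ δ)
    (hlarge : ∀ M : ℝ≥0, ∃ s > 0, ∀ t, 0 < t → t ≤ s → M * t ^ δ ≤ f t)
    (y : Y) {r : ℝ≥0} (hr : 0 < r) :
    hausdorffGauge f (ball y r ∩ limsup (fun i => ball (x i) (ρ i)) atTop) = ∞ := by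
  have hc₁ := h.lower_pos
  have hc₂ := h.upper_pos
  wlog hr₀ : 6 * r ≤ r₀ generalizing r
  · refine top_le_iff.1 ?_
    have hr6 : 0 < r₀ / 6 := div_pos h.radius_pos (by norm_num)
    rw [← this hr6 (by rw [mul_comm, div_mul_cancel₀ _ (by norm_num)])]
    refine measure_mono (inter_subset_inter_left _ (ball_subset_ball ?_))
    rw [NNReal.coe_le_coe, div_le_iff₀ (by norm_num), mul_comm]
    exact (not_le.1 hr₀).le
  have hfpos : ∀ s, 0 < s → 0 < f s := by
    intro s hs
    obtain ⟨s', hs', hle⟩ := hlarge 1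
    have hm : 0 < min s s' := lt_min hs hs'
    refine lt_of_lt_of_le ?_ (hf.monotone (min_le_left s s'))
    refine lt_of_lt_of_le ?_ (hle _ hm (min_le_right _ _))
    positivity
  have hRf : ∀ i, (f (ρ i) ^ (1 / δ)) ^ δ = f (ρ i) := fun i => by
    rw [← NNReal.rpow_mul, one_div_mul_cancel hδ.ne', NNReal.rpow_one]
  have hR : ∀ i, 0 < f (ρ i) ^ (1 / δ) := fun i => NNReal.rpow_pos (hfpos _ (hρ i))
  have hRlim : Tendsto (fun i => f (ρ i) ^ (1 / δ)) atTop (𝓝 0) := by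
    have h1 := ((hf.continuous.tendsto 0).comp hρlim)
    have h2 := ((NNReal.continuous_rpow_const (one_div_pos.2 hδ).le).tendsto (f 0)).comp h1
    rw [hf.map_zero, NNReal.zero_rpow (one_div_pos.2 hδ).ne'] at h2
    exact h2
  have hρR : ∀ᶠ i in atTop, 8 * ρ i ≤ f (ρ i) ^ (1 / δ) := by
    obtain ⟨s, hs, hle⟩ := hlarge (8 ^ δ)
    filter_upwards [hρlim.eventually (gt_mem_nhds hs)] with i hi
    rw [one_div, NNReal.le_rpow_inv_iff hδ, NNReal.mul_rpow]
    exact hle _ (hρ i) hi.le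
  obtain ⟨c, hc0, hc1, hc⟩ : ∃ c : ℝ≥0, 0 < c ∧ c < 1 ∧
      2 * ((c₂ * 12 ^ δ) * (c₂ * 6 ^ δ) * c) ≤ c₁ ^ 2 := by
    set D : ℝ≥0 := (c₂ * 12 ^ δ) * (c₂ * 6 ^ δ) with hD
    have hD0 : 0 < D := by positivity
    refine ⟨min (1 / 2) (c₁ ^ 2 / (2 * D)), by positivity,
      (min_le_left _ _).trans_lt (by norm_num), ?_⟩
    calc 2 * (D * min (1 / 2) (c₁ ^ 2 / (2 * D))) ≤ 2 * (D * (c₁ ^ 2 / (2 * D))) := by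
          gcongr
          exact min_le_right _ _
      _ = c₁ ^ 2 := by field_simp
  by_contra htop
  lift hausdorffGauge f (ball y r ∩ limsup (fun i => ball (x i) (ρ i)) atTop) to ℝ≥0
    using htop with M hM
  -- The cover will cost at most M + 2: M + 1 from the infimum and 1 from enlarging diameters. This
  -- ratio converts that cost into Σ t_j^δ ≤ c r^δ.
  obtain ⟨s₀, hs₀, hs₀le⟩ := hlarge ((M + 1 + 1) / (c * r ^ δ))
  set s := min s₀ r with hs
  have hs0 : 0 < s := lt_min hs₀ hr
  have hlt : hausdorffGauge f (ball y r ∩ limsup (fun i => ball (x i) (ρ i)) atTop) <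
      ((M + 1 : ℝ≥0) : ℝ≥0∞) := by
    rw [← hM]
    exact_mod_cast lt_add_one M
  rw [hausdorffGauge, Measure.mkMetric_apply] at hlt
  have hlt' := (le_iSup₂ (f := fun (r' : ℝ≥0∞) (_ : 0 < r') =>
    ⨅ (t : ℕ → Set Y) (_ : ball y r ∩ limsup (fun i => ball (x i) (ρ i)) atTop ⊆ ⋃ n, t n)
      (_ : ∀ n, ediam (t n) ≤ r'), ∑' n, ⨆ _ : (t n).Nonempty,
        (fun t : ℝ≥0∞ => if t = ∞ then ∞ else (f t.toNNReal : ℝ≥0∞)) (ediam (t n)))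
    ((s / 2 : ℝ≥0) : ℝ≥0∞) (by exact_mod_cast half_pos hs0)).trans_lt hlt
  simp only [iInf_lt_iff] at hlt'
  obtain ⟨U, hcover, hdiam, hU⟩ := hlt'
  obtain ⟨ε, hε, hεsum⟩ := ENNReal.exists_pos_sum_of_countable (one_ne_zero (α := ℝ≥0∞)) ℕ
  have hdtop : ∀ j, ediam (U j) ≠ ∞ := fun j => ne_top_of_le_ne_top ENNReal.coe_ne_top (hdiam j)
  -- Diameters may vanish, so each is replaced by a slightly larger positive t_j; continuity of f
  -- keeps the extra cost below ε_j.
  have hex : ∀ j, ∃ t : ℝ≥0, (ediam (U j)).toNNReal < t ∧ t ≤ s ∧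
      f t < f (ediam (U j)).toNNReal + ε j := by
    intro j
    have hds : (ediam (U j)).toNNReal < s :=
      (ENNReal.toNNReal_mono ENNReal.coe_ne_top (hdiam j)).trans_lt (NNReal.half_lt_self hs0.ne')
    have hev := ((hf.continuous.tendsto (ediam (U j)).toNNReal).mono_left
      (nhdsWithin_le_nhds (s := Ioi (ediam (U j)).toNNReal))).eventually (gt_mem_nhds (lt_add_of_pos_right _ (hε j)))
    obtain ⟨t, ht, ht'⟩ := (Filter.Eventually.and (Ioc_mem_nhdsGT hds) hev).exists
    exact ⟨t, ht.1, ht.2, ht'⟩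
  choose t htd hts htf using hex
  have ht0 : ∀ j, 0 < t j := fun j => pos_of_gt (htd j)
  have hsum : ∑' j, (f (t j) : ℝ≥0∞) ≤ ((M + 1 + 1 : ℝ≥0) : ℝ≥0∞) := by
    calc ∑' j, (f (t j) : ℝ≥0∞)
        ≤ ∑' j, ((⨆ _ : (U j).Nonempty, if ediam (U j) = ∞ then ∞ else
            (f (ediam (U j)).toNNReal : ℝ≥0∞)) + ε j) := by
          refine ENNReal.tsum_le_tsum fun j => ?_
          have h1 : (f (t j) : ℝ≥0∞) ≤ (f (ediam (U j)).toNNReal : ℝ≥0∞) + ε j := by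
            exact_mod_cast (htf j).le
          refine h1.trans (add_le_add_left ?_ _)
          rcases (U j).eq_empty_or_nonempty with he | hne
          · simp [he, hf.map_zero]
          · simp [hne, hdtop j]
      _ ≤ ((M + 1 : ℝ≥0) : ℝ≥0∞) + 1 := by
          rw [ENNReal.tsum_add]
          exact add_le_add hU.le hεsum.le
      _ = _ := by push_cast; rfl
  refine h.not_subset_iUnion hρ hρlim hR hRlim hρR hfull hf.monotone hRf hanti ht0
    (fun j a ha b hb => ?_) (ne_top_of_le_ne_top ENNReal.coe_ne_top hsum) hc0 hc1 hc hr hr₀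
    (fun j _ => (hts j).trans (min_le_right _ _)) ?_ hcover
  · refine le_trans ?_ (NNReal.coe_le_coe.2 (htd j).le)
    have := edist_le_ediam_of_mem ha hb
    rw [← ENNReal.coe_toNNReal (hdtop j), edist_nndist] at this
    exact_mod_cast this
  · calc ∑' j : meeting U (closedBall y r), ((t j ^ δ : ℝ≥0) : ℝ≥0∞)
        ≤ ∑' j, ((t j ^ δ : ℝ≥0) : ℝ≥0∞) := ENNReal.tsum_comp_le_tsum_of_injective
          Subtype.val_injective fun j => ((t j ^ δ : ℝ≥0) : ℝ≥0∞)
      _ ≤ ∑' j, ((c * r ^ δ / (M + 1 + 1) : ℝ≥0) : ℝ≥0∞) * (f (t j) : ℝ≥0∞) := by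
          refine ENNReal.tsum_le_tsum fun j => ?_
          rw [← ENNReal.coe_mul, ENNReal.coe_le_coe, div_mul_eq_mul_div,
            le_div_iff₀ (by positivity)]
          have h1 := hs₀le (t j) (ht0 j) ((hts j).trans (min_le_left _ _))
          rw [div_mul_eq_mul_div, div_le_iff₀ (by positivity)] at h1
          linarith
      _ ≤ ((c * r ^ δ / (M + 1 + 1) : ℝ≥0) : ℝ≥0∞) * ((M + 1 + 1 : ℝ≥0) : ℝ≥0∞) := by
          rw [ENNReal.tsum_mul_left]
          gcongr
      _ = ((c * r ^ δ : ℝ≥0) : ℝ≥0∞) := by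
          rw [← ENNReal.coe_mul, div_mul_cancel₀ _ (by positivity)]

end Infinite

/-! ### Bounded ratio: shrinking limsup balls, and absolute continuity -/

section Comparable

variable {Y : Type*} [MetricSpace Y] [MeasurableSpace Y]
  {δ : ℝ} {c₁ c₂ r₀ : ℝ≥0} {ν : Measure Y}

theorem HasBallGrowth.isLocallyFiniteMeasure (h : HasBallGrowth δ c₁ c₂ r₀ ν) :
    IsLocallyFiniteMeasure ν :=
  ⟨fun x => ⟨ball x r₀, ball_mem_nhds x (by exact_mod_cast h.radius_pos),
    (h.ball_le x r₀ h.radius_pos le_rfl).trans_lt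
      (ENNReal.mul_lt_top ENNReal.coe_lt_top ENNReal.coe_lt_top)⟩⟩

/-- Doubling gives access to the density argument behind `blimsup_thickening_mul_ae_eq`. -/
theorem HasBallGrowth.isUnifLocDoublingMeasure (h : HasBallGrowth δ c₁ c₂ r₀ ν) :
    IsUnifLocDoublingMeasure ν := by
  have hc₁ := h.lower_pos
  refine ⟨⟨c₂ * 3 ^ δ / c₁, ?_⟩⟩
  have hr : (0 : ℝ) < r₀ / 3 := by exact_mod_cast div_pos h.radius_pos (by norm_num)
  filter_upwards [Ioo_mem_nhdsGT hr] with ε hε x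
  lift ε to ℝ≥0 using hε.1.le
  have hε0 : 0 < ε := by exact_mod_cast hε.1
  have hε1 := hε.2
  have hle : 3 * ε ≤ r₀ := by
    rw [← NNReal.coe_le_coe]
    push_cast
    linarith
  calc ν (closedBall x (2 * ε)) ≤ ν (ball x ((3 * ε : ℝ≥0) : ℝ)) := by
        refine measure_mono (closedBall_subset_ball ?_)
        push_cast
        linarith [hε.1]
    _ ≤ c₂ * ((3 * ε) ^ δ : ℝ≥0) := h.ball_le x _ (by positivity) hle
    _ = ((c₂ * 3 ^ δ / c₁ : ℝ≥0) : ℝ≥0∞) * (c₁ * (ε ^ δ : ℝ≥0)) := by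
        rw [NNReal.mul_rpow]
        norm_cast
        field_simp
    _ ≤ ((c₂ * 3 ^ δ / c₁ : ℝ≥0) : ℝ≥0∞) * ν (closedBall x ε) := by
        gcongr
        refine (h.le_ball x ε hε0 ?_).trans (measure_mono ball_subset_closedBall)
        exact le_trans (le_mul_of_one_le_left zero_le (by norm_num)) hle

/-- Shrinking the balls of a limsup set by a bounded factor only changes it by a null set. -/
theorem HasBallGrowth.ae_mem_limsup_ball [BorelSpace Y] [SecondCountableTopology Y]
    (h : HasBallGrowth δ c₁ c₂ r₀ ν) {x : ℕ → Y} {ρ R : ℕ → ℝ≥0}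
    (hρlim : Tendsto ρ atTop (𝓝 0)) {C : ℝ≥0} (hC : 0 < C) (hR : ∀ᶠ i in atTop, R i ≤ C * ρ i)
    (hfull : ∀ᵐ z ∂ν, ∃ᶠ i in atTop, z ∈ ball (x i) (R i)) :
    ∀ᵐ z ∂ν, z ∈ limsup (fun i => ball (x i) (ρ i)) atTop := by
  have := h.isLocallyFiniteMeasure
  have := h.isUnifLocDoublingMeasure
  have heq := blimsup_thickening_mul_ae_eq ν (fun _ => True) (fun i => {x i})
    (M := (C : ℝ)) (by exact_mod_cast hC) (fun i => (ρ i : ℝ)) (NNReal.tendsto_coe.2 hρlim)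
  simp only [blimsup_true, thickening_singleton] at heq
  filter_upwards [hfull, heq.mem_iff] with z hz hiff
  refine hiff.1 ?_
  rw [mem_limsup_iff_frequently_mem]
  refine (hz.and_eventually hR).mono fun i hi => ?_
  exact ball_subset_ball (by exact_mod_cast hi.2) hi.1

theorem hausdorffGauge_le_smul [BorelSpace Y] (hδ : 0 < δ) {f : ℝ≥0 → ℝ≥0}
    (hf : IsDimensionFunction f) {C s : ℝ≥0} (hC : 0 < C) (hs : 0 < s)
    (hle : ∀ t, 0 < t → t ≤ s → f t ≤ C * t ^ δ) :
    (hausdorffGauge f : Measure Y) ≤ (C : ℝ≥0∞) • μH[δ] := by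
  refine Measure.mkMetric_mono_smul ENNReal.coe_ne_top (by exact_mod_cast hC.ne') ?_
  have hs' : (0 : ℝ≥0∞) < s := by exact_mod_cast hs
  filter_upwards [Ico_mem_nhdsGE hs'] with t ht
  lift t to ℝ≥0 using (ht.2.trans ENNReal.coe_lt_top).ne
  have hts : t ≤ s := by exact_mod_cast ht.2.le
  simp only [ENNReal.coe_ne_top, if_false, ENNReal.toNNReal_coe, Pi.smul_apply, smul_eq_mul]
  rw [← ENNReal.coe_rpow_of_nonneg _ hδ.le, ← ENNReal.coe_mul, ENNReal.coe_le_coe]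
  rcases eq_or_ne t 0 with rfl | h0
  · simp [hf.map_zero]
  · exact hle t (pos_iff_ne_zero.2 h0) hts

end Comparable

/-! ### Dichotomy for the gauge, and the principle in a complete space -/

/-- If `r ^ (-δ) f r` is monotonic then either it is bounded near zero, or it is decreasing with
infinite limit at zero. -/
theorem gauge_bounded_or_large {δ : ℝ} {f : ℝ≥0 → ℝ≥0}
    (hf_mono : MonotoneOn (fun r : ℝ≥0 => r ^ (-δ) * f r) (Ioi 0) ∨
      AntitoneOn (fun r : ℝ≥0 => r ^ (-δ) * f r) (Ioi 0)) :
    (∃ C > 0, ∃ s > 0, ∀ t : ℝ≥0, 0 < t → t ≤ s → f t ≤ C * t ^ δ) ∨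
      ((∀ s t : ℝ≥0, 0 < s → s ≤ t → f t * s ^ δ ≤ f s * t ^ δ) ∧
        ∀ M : ℝ≥0, ∃ s > 0, ∀ t, 0 < t → t ≤ s → M * t ^ δ ≤ f t) := by
  have hmul : ∀ t : ℝ≥0, 0 < t → t ^ (-δ) * f t * t ^ δ = f t := fun t ht => by
    have : 0 < t ^ δ := by positivity
    rw [NNReal.rpow_neg]
    field_simp
  by_cases hb : ∃ C > 0, ∃ s > 0, ∀ t : ℝ≥0, 0 < t → t ≤ s → f t ≤ C * t ^ δ
  · exact Or.inl hb
  refine Or.inr ?_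
  rcases hf_mono with hm | ha
  · refine absurd ⟨f 1 + 1, by positivity, 1, one_pos, fun t ht ht1 => ?_⟩ hb
    have := hm (mem_Ioi.2 ht) (mem_Ioi.2 one_pos) ht1
    rw [← hmul t ht]
    gcongr
    refine this.trans ?_
    simp
  · refine ⟨fun s t hs hst => ?_, fun M => ?_⟩
    · have ht := hs.trans_le hst
      have := ha (mem_Ioi.2 hs) (mem_Ioi.2 ht) hst
      calc f t * s ^ δ = t ^ (-δ) * f t * (t ^ δ * s ^ δ) := by
            rw [← mul_assoc, hmul t ht]
        _ ≤ s ^ (-δ) * f s * (t ^ δ * s ^ δ) := by gcongr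
        _ = s ^ (-δ) * f s * s ^ δ * t ^ δ := by ring
        _ = f s * t ^ δ := by rw [hmul s hs]
    · push Not at hb
      -- One point s with a large ratio suffices, since the ratio only grows towards 0.
      obtain ⟨s, hs, -, hlt⟩ := hb (M + 1) (by positivity) 1 one_pos
      refine ⟨s, hs, fun t ht hts => ?_⟩
      have := ha (mem_Ioi.2 ht) (mem_Ioi.2 hs) hts
      rw [← hmul t ht]
      gcongr
      refine le_trans ?_ this
      have hsδ : 0 < s ^ δ := by positivity
      rw [← hmul s hs] at hlt
      exact le_self_add.trans (lt_of_mul_lt_mul_right hlt zero_le).le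

/-- The mass transference principle in a complete separable metric space which carries an Ahlfors
regular measure. -/
theorem HasBallGrowth.mass_transference {Y : Type*} [MetricSpace Y] [MeasurableSpace Y]
    [BorelSpace Y] [CompleteSpace Y] [SecondCountableTopology Y]
    {δ : ℝ} {c₁ c₂ r₀ : ℝ≥0} {ν : Measure Y} (h : HasBallGrowth δ c₁ c₂ r₀ ν) (hδ : 0 < δ)
    {x : ℕ → Y} {ρ : ℕ → ℝ≥0} (hρ : ∀ i, 0 < ρ i) (hρlim : Tendsto ρ atTop (𝓝 0))
    {f : ℝ≥0 → ℝ≥0} (hf : IsDimensionFunction f)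
    (hf_mono : MonotoneOn (fun r : ℝ≥0 => r ^ (-δ) * f r) (Ioi 0) ∨
      AntitoneOn (fun r : ℝ≥0 => r ^ (-δ) * f r) (Ioi 0))
    (hfull : ∀ y : Y, ∀ r : ℝ≥0, 0 < r →
      μH[δ] (ball y r ∩ limsup (fun i => ball (x i) ((f (ρ i) ^ (1 / δ) : ℝ≥0) : ℝ)) atTop) =
        μH[δ] (ball y (r : ℝ)))
    (y : Y) {r : ℝ≥0} (hr : 0 < r) :
    hausdorffGauge f (ball y r ∩ limsup (fun i => ball (x i) (ρ i)) atTop) =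
      hausdorffGauge f (ball y (r : ℝ)) := by
  have hH := h.hausdorffMeasure hδ
  set S := limsup (fun i => ball (x i) ((f (ρ i) ^ (1 / δ) : ℝ≥0) : ℝ)) atTop with hS
  have hSm : MeasurableSet S := MeasurableSet.measurableSet_limsup fun _ => measurableSet_ball
  have hae : ∀ᵐ z ∂(μH[δ] : Measure Y),
      ∃ᶠ i in atTop, z ∈ ball (x i) ((f (ρ i) ^ (1 / δ) : ℝ≥0) : ℝ) := by
    suffices hnull : μH[δ] Sᶜ = 0 by
      filter_upwards [compl_mem_ae_iff.2 hnull] with z hz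
      rw [compl_compl] at hz
      exact mem_limsup_iff_frequently_mem.1 hz
    -- H^δ may be infinite globally, so the equality of measures is subtracted only on small balls,
    -- where it is finite.
    refine measure_null_of_locally_null _ fun z _ => ⟨Sᶜ ∩ ball z ((r₀ / 2 : ℝ≥0) : ℝ),
      inter_mem_nhdsWithin _ (ball_mem_nhds z (by exact_mod_cast hH.radius_pos)), ?_⟩
    have hfin : μH[δ] (ball z ((r₀ / 2 : ℝ≥0) : ℝ)) ≠ ∞ :=
      ne_top_of_le_ne_top (ENNReal.mul_ne_top ENNReal.coe_ne_top ENNReal.coe_ne_top)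
        (hH.ball_le z _ hH.radius_pos le_rfl)
    have hadd := measure_inter_add_sdiff (μ := (μH[δ] : Measure Y))
      (ball z ((r₀ / 2 : ℝ≥0) : ℝ)) hSm
    rw [hfull z _ hH.radius_pos] at hadd
    rw [inter_comm, ← sdiff_eq]
    exact (ENNReal.add_right_inj hfin).1 (hadd.trans (add_zero _).symm)
  rcases gauge_bounded_or_large hf_mono with ⟨C, hC, s, hs, hle⟩ | ⟨hanti, hlarge⟩
  · have hev : ∀ᶠ i in atTop, f (ρ i) ^ (1 / δ) ≤ C ^ (1 / δ) * ρ i := by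
      filter_upwards [hρlim.eventually (gt_mem_nhds hs)] with i hi
      rw [one_div, NNReal.rpow_inv_le_iff hδ, NNReal.mul_rpow, NNReal.rpow_inv_rpow hδ.ne']
      exact hle _ (hρ i) hi.le
    have hnull := hH.ae_mem_limsup_ball hρlim (NNReal.rpow_pos hC) hev hae
    have hac := Measure.absolutelyContinuous_of_le_smul
      (hausdorffGauge_le_smul (Y := Y) hδ hf hC hs hle)
    refine measure_congr ?_
    filter_upwards [hac.ae_le hnull] with z hz
    exact propext ⟨fun hzy => hzy.1, fun hzy => ⟨hzy, hz⟩⟩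
  · have htop := hH.hausdorffGauge_eq_top hδ hρ hρlim hf hae hanti hlarge y hr
    rw [htop]
    exact (top_le_iff.1 (htop.ge.trans (measure_mono inter_subset_left))).symm

/-! ### Passage between X as a subset and X as a space -/

theorem Isometry.hausdorffGauge_image {Y Z : Type*} [MetricSpace Y] [MeasurableSpace Y]
    [BorelSpace Y] [MetricSpace Z] [MeasurableSpace Z] [BorelSpace Z] {f : ℝ≥0 → ℝ≥0}
    (hf : Monotone f) {φ : Y → Z} (hφ : Isometry φ) (s : Set Y) :
    hausdorffGauge f (φ '' s) = hausdorffGauge f s := by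
  simp only [hausdorffGauge, ← OuterMeasure.coe_mkMetric, ← OuterMeasure.comap_apply]
  rw [OuterMeasure.isometry_comap_mkMetric _ hφ (Or.inl fun a b hab => ?_)]
  split_ifs with ha hb hb
  · exact le_rfl
  · exact absurd (top_le_iff.1 (ha ▸ hab)) hb
  · exact le_top
  · exact ENNReal.coe_le_coe.2 (hf (ENNReal.toNNReal_mono hb hab))

theorem image_val_ball {Y : Type*} [MetricSpace Y] {X : Set Y} (y : X) (r : ℝ≥0) :
    Subtype.val '' ball y (r : ℝ) = ballIn X y r := by
  ext z
  simp only [ballIn, mem_image, mem_ball, mem_inter_iff, Subtype.exists, Subtype.dist_eq]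
  exact ⟨fun ⟨a, ha, hd, e⟩ => e ▸ ⟨hd, ha⟩, fun ⟨hd, hz⟩ => ⟨z, hz, hd, rfl⟩⟩

theorem image_val_ball_inter_limsup {Y : Type*} [MetricSpace Y] {X : Set Y} (y : X) (r : ℝ≥0)
    (x : ℕ → X) (ρ : ℕ → ℝ≥0) :
    Subtype.val '' (ball y (r : ℝ) ∩ limsup (fun i => ball (x i) (ρ i : ℝ)) atTop) =
      ballIn X y r ∩ limsup (fun i => ballIn X (x i) (ρ i)) atTop := by
  ext z
  simp only [← image_val_ball, mem_image, mem_inter_iff, mem_limsup_iff_frequently_mem]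
  constructor
  · rintro ⟨a, ⟨ha, hl⟩, rfl⟩
    exact ⟨⟨a, ha, rfl⟩, hl.mono fun i hi => ⟨a, hi, rfl⟩⟩
  · rintro ⟨⟨a, ha, rfl⟩, hl⟩
    exact ⟨a, ⟨ha, hl.mono fun i ⟨b, hb, e⟩ => Subtype.ext e ▸ hb⟩, rfl⟩

theorem IsAhlforsRegular.isClosed {Y : Type*} [MetricSpace Y] [MeasurableSpace Y] {δ : ℝ}
    {X : Set Y} (hX : IsAhlforsRegular δ X) : IsClosed X := by
  obtain ⟨μ, -, rfl⟩ := hX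
  exact Measure.isClosed_support

theorem IsAhlforsRegular.exists_hasBallGrowth {Y : Type*} [MetricSpace Y] [MeasurableSpace Y]
    [BorelSpace Y] [SecondCountableTopology Y] {δ : ℝ} {X : Set Y} (hX : IsAhlforsRegular δ X) :
    ∃ (c₁ c₂ r₀ : ℝ≥0) (ν : Measure X), HasBallGrowth δ c₁ c₂ r₀ ν := by
  have hclosed := hX.isClosed
  obtain ⟨μ, ⟨c₁, c₂, r₀, hc₁, -, hc₂, hr₀, hμ⟩, hsupp⟩ := hX
  lift c₁ to ℝ≥0 using hc₁.le
  lift c₂ to ℝ≥0 using zero_le_one.trans hc₂.le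
  lift r₀ to ℝ≥0 using hr₀.le
  have hball : ∀ (y : X) (r : ℝ≥0),
      μ.comap Subtype.val (ball y (r : ℝ)) = μ (ball (y : Y) (r : ℝ)) := fun y r => by
    rw [(MeasurableEmbedding.subtype_coe hclosed.measurableSet).comap_apply, image_val_ball,
      ballIn]
    -- Balls of the ambient space lose no mass when cut down to X, as the complement of the support
    -- is null.
    exact measure_inter_conull (hsupp ▸ Measure.measure_compl_support)
  have hof : ∀ c r : ℝ≥0, ENNReal.ofReal (c * (r : ℝ) ^ δ) = (c : ℝ≥0∞) * (r ^ δ : ℝ≥0) :=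
    fun c r => by
      rw [← NNReal.coe_rpow, ← NNReal.coe_mul, ENNReal.ofReal_coe_nnreal, ENNReal.coe_mul]
  have hμ' : ∀ (y : X) (r : ℝ≥0), 0 < r → r ≤ r₀ →
      (c₁ : ℝ≥0∞) * (r ^ δ : ℝ≥0) ≤ μ (ball (y : Y) (r : ℝ)) ∧
        μ (ball (y : Y) (r : ℝ)) ≤ (c₂ : ℝ≥0∞) * (r ^ δ : ℝ≥0) := fun y r hr hrr => by
    rw [← hof, ← hof]
    exact hμ y (hsupp ▸ y.2) r (by exact_mod_cast hr) (by exact_mod_cast hrr)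
  refine ⟨c₁, c₂, r₀, μ.comap Subtype.val, by exact_mod_cast hc₁,
    by exact_mod_cast zero_lt_one.trans hc₂, by exact_mod_cast hr₀,
    fun y r hr hrr => ?_, fun y r hr hrr => ?_⟩
  · rw [hball]
    exact (hμ' y r hr hrr).1
  · rw [hball]
    exact (hμ' y r hr hrr).2

theorem theorem1p4 (d : ℕ) (δ : ℝ) (hδ : 0 < δ)
    (X : Set (EuclideanSpace ℝ (Fin d))) (hX : IsAhlforsRegular δ X)
    (x : ℕ → EuclideanSpace ℝ (Fin d)) (ρ : ℕ → ℝ≥0)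
    (hx : ∀ i, x i ∈ X) (hρ : ∀ i, 0 < ρ i) (hρ_lim : Tendsto ρ atTop (𝓝 0))
    (f : ℝ≥0 → ℝ≥0) (hf : IsDimensionFunction f)
    (hf_mono : MonotoneOn (fun r : ℝ≥0 => r ^ (-δ) * f r) (Ioi 0) ∨
      AntitoneOn (fun r : ℝ≥0 => r ^ (-δ) * f r) (Ioi 0))
    (h_full : ∀ y ∈ X, ∀ r : ℝ≥0, 0 < r →
      Measure.hausdorffMeasure δ
          (ballIn X y r ∩ limsup (fun i => ballIn X (x i) ((f (ρ i)) ^ (1 / δ))) atTop) =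
        Measure.hausdorffMeasure δ (ballIn X y r)) :
    ∀ y ∈ X, ∀ r : ℝ≥0, 0 < r →
      hausdorffGauge f (ballIn X y r ∩ limsup (fun i => ballIn X (x i) (ρ i)) atTop) =
        hausdorffGauge f (ballIn X y r) := by
  have hclosed := hX.isClosed
  obtain ⟨c₁, c₂, r₀, ν, hν⟩ := hX.exists_hasBallGrowth
  have : CompleteSpace X := hclosed.isComplete.completeSpace_coe
  have hiso : Isometry (Subtype.val : X → EuclideanSpace ℝ (Fin d)) := isometry_subtype_coe
  intro y hy r hr
  lift x to ℕ → X using hx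
  have key := hν.mass_transference hδ hρ hρ_lim hf hf_mono (x := x) (fun z s hs => ?_) ⟨y, hy⟩ hr
  · rw [← hiso.hausdorffGauge_image hf.monotone,
      ← hiso.hausdorffGauge_image hf.monotone, image_val_ball_inter_limsup,
      image_val_ball] at key
    exact key
  · rw [← hiso.hausdorffMeasure_image (Or.inl hδ.le),
      ← hiso.hausdorffMeasure_image (Or.inl hδ.le), image_val_ball_inter_limsup,
      image_val_ball]
    exact h_full z z.2 s hs
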